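/- **Definitions.** A *pair of combinatorial multicones* of rank $q$ is a finite cyclically ordered set $M$ partitioned into two sets $M_s$, $M_u$ with $q$ elements each, which are met alternately according to the cyclic order; $x^+$ denotes the element next to $x$. A *correspondence* is a subset of $M\times M$; correspondences form a monoid under $C\circ C'=\{(x,z):\exists y,\ (x,y)\in C,\ (y,z)\in C'\}$. A correspondence $C$ is *monotonic* if $C\subset (M_s\times M_s)\sqcup(M_u\times M_u)$, $C\cap(M_s\times M_s)=\{(C_s(y),y): y\in M_s\}$ and $C\cap(M_u\times M_u)=\{(x,C_u(x)): x\in M_u\}$ for some maps $C_s:M_s\to M_s$, $C_u:M_u\to M_u$, and $C$ can be cyclically ordered so that the element next to $(x,y)$ is always $(x^{++},y)$, $(x^+,y^+)$ or $(x,y^{++})$. Let $\mathcal C(M)$ be the monoid of monotonic correspondences and $\mathcal F_N$ the free monoid on $N$ generators $a_1,\dots,a_N$. A morphism $\Phi:\mathcal F_N\to\mathcal C(M)$, with $C^{(i)}=\Phi(a_i)$, is *tight* if $\bigcup_i \operatorname{Im} C^{(i)}_u=M_u$ and $\bigcup_i \operatorname{Im} C^{(i)}_s=M_s$; it is *hyperbolic*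 if there is $\ell\ge1$ such that the image of every word of length $\ge\ell$ is a constant correspondence $M_u\times\{a_u\}\sqcup\{a_s\}\times M_s$ with $a_u\in M_u$, $a_s\in M_s$. An $N$-tuple $(A_1,\dots,A_N)\in SL(2,\mathbb R)^N$ is *uniformly hyperbolic* if the cocycle $x\mapsto A_{x_0}$ over the full shift $\sigma$ on $\{1,\dots,N\}^{\mathbb Z}$ has continuous invariant stable and unstable directions $e^s,e^u:\{1,\dots,N\}^{\mathbb Z}\to\mathbb P^1$, i.e. $A_{x_0}e^{s}(x)=e^{s}(\sigma x)$, $A_{x_0}e^{u}(x)=e^{u}(\sigma x)$, and for some $c>0$, $\lambda>1$ and all $x$ and $n\ge0$, $\|A_{x_{n-1}}\cdots A_{x_0}v\|\le c\lambda^{-n}\|v\|$ for $v\in e^s(x)$ and $\|A_{x_{-n}}^{-1}\cdots A_{x_{-1}}^{-1}v\|\le c\lambda^{-n}\|v\|$ for $v\in e^u(x)$. Let $K^u,K^s$ be the images of $e^u,e^s$. The *unstable core* $U$ is the complement of the union of the connected components of $\mathbb P^1\setminus K^u$ that intersect $K^s$; the *stable core* $S$ is defined by exchanging the roles of $K^u$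 and $K^s$. A morphism $\Phi:\mathcal F_N\to\mathcal C(M)$ is *induced* by $(A_1,\dots,A_N)$ if $M_u$ and $M_s$ can be identified with the sets of connected components of $U$ and of $S$ respectively, so that the cyclic order of $M$ is the one induced by an orientation of $\mathbb P^1$ and, for every $i$, $C^{(i)}$ is the set of pairs $(x,y)\in(M_u\times M_u)\sqcup(M_s\times M_s)$ with $A_i(x)\cap y\neq\emptyset$. **Proposition.** There exist an integer $N\ge2$, a pair of combinatorial multicones $M$ of rank $15$, and a tight hyperbolic morphism $\Phi:\mathcal F_N\to\mathcal C(M)$ which is not induced by any uniformly hyperbolic $N$-tuple of matrices in $SL(2,\mathbb R)$. -/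

import Mathlib

namespace MulticoneDynamics

/-! ### Finite cyclic orders and pairs of combinatorial multicones -/

/-- `y` is the element next to `x` in a cyclic order, usually denoted `y = x⁺`.  In a finite
cyclically ordered set with at least two elements, every `x` has exactly one next element. -/
def IsNext {α : Type*} [CircularOrder α] (x y : α) : Prop :=
  x ≠ y ∧ ∀ z, ¬ sbtw x z y

/-- A pair of combinatorial multicones: a finite cyclically ordered set `M`, partitioned into two
sets of the same cardinality which are met alternately according to the cyclic order. -/
structure MulticonePair (M : Type*) [Finite M] [CircularOrder M] where
  /-- the stable combinatorial multicone `M_s` -/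
  stable : Set M
  /-- the unstable combinatorial multicone `M_u` -/
  unstable : Set M
  isCompl : IsCompl stable unstable
  ncard_eq : stable.ncard = unstable.ncard
  alternate : ∀ x y, IsNext x y → (x ∈ stable ↔ y ∈ unstable)

/-- The rank of a pair of combinatorial multicones. -/
noncomputable def MulticonePair.rank {M : Type*} [Finite M] [CircularOrder M]
    (P : MulticonePair M) : ℕ :=
  P.unstable.ncard

/-! ### The monoid of correspondences -/

/-- A correspondence on `M` is a subset of `M × M`. -/
def Correspondence (M : Type*) : Type _ := Set (M × M)

namespace Correspondence

instance {M : Type*} : Membership (M × M) (Correspondence M) :=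
  inferInstanceAs (Membership (M × M) (Set (M × M)))

/-- The correspondences form a monoid under composition,
`C * C' = {(x, z) | ∃ y, (x, y) ∈ C ∧ (y, z) ∈ C'}`, with the diagonal as identity. -/
instance {M : Type*} : Monoid (Correspondence M) where
  mul C C' := {p : M × M | ∃ y, (p.1, y) ∈ C ∧ (y, p.2) ∈ C'}
  one := {p : M × M | p.1 = p.2}
  mul_assoc A B C := by
    refine Set.ext fun p => ⟨?_, ?_⟩
    · rintro ⟨y, ⟨z, h1, h2⟩, h3⟩
      exact ⟨z, h1, y, h2, h3⟩
    · rintro ⟨z, h1, y, h2, h3⟩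
      exact ⟨y, ⟨z, h1, h2⟩, h3⟩
  one_mul A := by
    refine Set.ext fun p => ⟨?_, fun h => ⟨p.1, rfl, h⟩⟩
    rintro ⟨y, h1, h2⟩
    obtain rfl : p.1 = y := h1
    exact h2
  mul_one A := by
    refine Set.ext fun p => ⟨?_, fun h => ⟨p.2, h, rfl⟩⟩
    rintro ⟨y, h1, h2⟩
    obtain rfl : y = p.2 := h2
    exact h1

theorem mem_mul {M : Type*} {C C' : Correspondence M} {p : M × M} :
    p ∈ C * C' ↔ ∃ y, (p.1, y) ∈ C ∧ (y, p.2) ∈ C' := Iff.rfl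

theorem mem_one {M : Type*} {p : M × M} :
    p ∈ (1 : Correspondence M) ↔ p.1 = p.2 := Iff.rfl

end Correspondence

/-- The pair `p'` is `(x⁺⁺, y)` or `(x⁺, y⁺)` or `(x, y⁺⁺)`, where `p = (x, y)`. -/
def IsStep {M : Type*} [CircularOrder M] (p p' : M × M) : Prop :=
  ((∃ t, IsNext p.1 t ∧ IsNext t p'.1) ∧ p'.2 = p.2) ∨
  (IsNext p.1 p'.1 ∧ IsNext p.2 p'.2) ∨
  (p'.1 = p.1 ∧ ∃ t, IsNext p.2 t ∧ IsNext t p'.2)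

section Pair

variable {M : Type*} [Finite M] [CircularOrder M] (P : MulticonePair M)

/-- Monotonic correspondences: the stable part of `C` is the graph `{(C_s y, y)}` of a map
`C_s : M_s → M_s`, the unstable part is the graph `{(x, C_u x)}` of a map `C_u : M_u → M_u`, and
`C` can be cyclically ordered so that the element next to `(x, y)` is always
`(x⁺⁺, y)`, `(x⁺, y⁺)` or `(x, y⁺⁺)`. -/
structure MulticonePair.IsMonotonic (C : Correspondence M) : Prop where
  same_type : ∀ p ∈ C,
    (p.1 ∈ P.stable ∧ p.2 ∈ P.stable) ∨ (p.1 ∈ P.unstable ∧ p.2 ∈ P.unstable)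
  stable_map : ∀ y ∈ P.stable, ∃! x, x ∈ P.stable ∧ (x, y) ∈ C
  unstable_map : ∀ x ∈ P.unstable, ∃! y, y ∈ P.unstable ∧ (x, y) ∈ C
  cyclic : ∃ _ : CircularOrder {p : M × M // p ∈ C},
    ∀ p p' : {p : M × M // p ∈ C}, IsNext p p' → IsStep p.1 p'.1

/-- The set `𝒞(M)` of monotonic correspondences, inside the monoid of all correspondences. -/
def MulticonePair.monotonic : Set (Correspondence M) := {C | P.IsMonotonic C}

/-- The constant correspondence `M_u × {a_u} ⊔ {a_s} × M_s`. -/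
def MulticonePair.const (as au : M) : Correspondence M :=
  {p : M × M | (p.1 ∈ P.unstable ∧ p.2 = au) ∨ (p.1 = as ∧ p.2 ∈ P.stable)}

/-- The image of the map `C_u`. -/
def MulticonePair.imageU (C : Correspondence M) : Set M :=
  {y | y ∈ P.unstable ∧ ∃ x ∈ P.unstable, (x, y) ∈ C}

/-- The image of the map `C_s`. -/
def MulticonePair.imageS (C : Correspondence M) : Set M :=
  {x | x ∈ P.stable ∧ ∃ y ∈ P.stable, (x, y) ∈ C}

variable {N : ℕ} (Φ : FreeMonoid (Fin N) →* Correspondence M)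

/-- `Φ` is hyperbolic: there is `ℓ ≥ 1` such that the image of every word of length `≥ ℓ` is a
constant correspondence. -/
def MulticonePair.IsHyperbolic : Prop :=
  ∃ ℓ : ℕ, 1 ≤ ℓ ∧ ∀ w : FreeMonoid (Fin N), ℓ ≤ w.length →
    ∃ as ∈ P.stable, ∃ au ∈ P.unstable, Φ w = P.const as au

/-- `Φ` is tight: the images of the maps `C_u^{(i)}` cover `M_u`, and the images of the maps
`C_s^{(i)}` cover `M_s`, where `C^{(i)}` is the image of the `i`-th generator. -/
def MulticonePair.IsTight : Prop :=
  (⋃ i, P.imageU (Φ (FreeMonoid.of i))) = P.unstable ∧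
  (⋃ i, P.imageS (Φ (FreeMonoid.of i))) = P.stable

end Pair

/-! ### The projective line -/

/-- The real projective line, the set of lines through the origin in `ℝ²`.  The group `SL(2, ℝ)`
acts on it through its linear action on `ℝ²`. -/
abbrev P1 : Type := Projectivization ℝ (Fin 2 → ℝ)

/-- The usual (quotient) topology of the projective line. -/
noncomputable instance : TopologicalSpace P1 :=
  TopologicalSpace.coinduced
    (fun v : {v : Fin 2 → ℝ // v ≠ 0} => Projectivization.mk ℝ v.1 v.2) inferInstance

/-- The determinant of two vectors of the plane. -/
def det2 (u v : Fin 2 → ℝ) : ℝ := u 0 * v 1 - u 1 * v 0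

/-- The standard (counterclockwise) cyclic order of the projective line: starting from `p` and
turning counterclockwise, one meets `q` before `r`, and the three points are distinct.  Each point
occurs in two of the three determinants, so the sign does not depend on the representatives. -/
def P1.Sbtw (p q r : P1) : Prop :=
  0 < det2 p.rep q.rep * det2 q.rep r.rep * det2 p.rep r.rep

/-- The set of connected components of `X`. -/
def components (X : Set P1) : Set (Set P1) := connectedComponentIn X '' X

/-- The complement of the union of those connected components of `P1 ∖ K` which intersect `L`. -/
def core (K L : Set P1) : Set P1 := (⋃₀ {c ∈ components Kᶜ | (c ∩ L).Nonempty})ᶜ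

/-! ### Uniformly hyperbolic tuples of matrices -/

section Matrices

variable {N : ℕ} (A : Fin N → Matrix.SpecialLinearGroup (Fin 2) ℝ)

/-- The left shift on the full shift `N^ℤ`. -/
def shift (x : ℤ → Fin N) : ℤ → Fin N := fun k => x (k + 1)

/-- The product `Aⁿ(x) = A_{x_{n-1}} ⋯ A_{x_0}`. -/
def cocycle (x : ℤ → Fin N) : ℕ → Matrix.SpecialLinearGroup (Fin 2) ℝ
  | 0 => 1
  | n + 1 => A (x n) * cocycle x n

/-- The product `A⁻ⁿ(x) = A_{x_{-n}}⁻¹ ⋯ A_{x_{-1}}⁻¹`. -/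
def cocycleInv (x : ℤ → Fin N) : ℕ → Matrix.SpecialLinearGroup (Fin 2) ℝ
  | 0 => 1
  | n + 1 => (A (x (-(n + 1 : ℤ))))⁻¹ * cocycleInv x n

/-- `es`, `eu` are the stable and unstable directions of the cocycle over the full shift `N^ℤ`
given by `x ↦ A_{x_0}`: they are continuous and invariant, the lines `es x` are uniformly
exponentially contracted in the future and the lines `eu x` in the past.  (All norms on `ℝ²` being
equivalent, the choice of the norm is irrelevant.) -/
structure IsHyperbolicSplitting (es eu : (ℤ → Fin N) → P1) : Prop where
  continuous_s : Continuous es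
  continuous_u : Continuous eu
  invariant_s : ∀ x, A (x 0) • es x = es (shift x)
  invariant_u : ∀ x, A (x 0) • eu x = eu (shift x)
  contraction : ∃ c l : ℝ, 0 < c ∧ 1 < l ∧ ∀ (x : ℤ → Fin N) (n : ℕ),
    (∀ v ∈ (es x).submodule, ‖cocycle A x n • v‖ ≤ c * (l ^ n)⁻¹ * ‖v‖) ∧
    (∀ v ∈ (eu x).submodule, ‖cocycleInv A x n • v‖ ≤ c * (l ^ n)⁻¹ * ‖v‖)

/-- The `N`-tuple `A` is uniformly hyperbolic with respect to the full shift. -/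
def IsUniformlyHyperbolic : Prop := ∃ es eu, IsHyperbolicSplitting A es eu

/-- The unstable core of a tuple with stable and unstable directions `es`, `eu`. -/
def unstableCore (es eu : (ℤ → Fin N) → P1) : Set P1 := core (Set.range eu) (Set.range es)

/-- The stable core of a tuple with stable and unstable directions `es`, `eu`. -/
def stableCore (es eu : (ℤ → Fin N) → P1) : Set P1 := core (Set.range es) (Set.range eu)

variable {M : Type*} [Finite M] [CircularOrder M]

/-- `Φ` is the morphism induced by the uniformly hyperbolic tuple `A`, up to an identification
`e` of `M` with the cyclically ordered set of the connected components of the two cores: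
`M_u` is identified with the set of components of the unstable core and `M_s` with the set of
components of the stable core, the cyclic order of `M` is the one induced by an orientation of the
projective line, and the image of the `i`-th generator consists of the pairs `(x, y)` of components
of the same core such that `A_i(x)` intersects `y`. -/
def MulticonePair.IsInducedBy (P : MulticonePair M) (Φ : FreeMonoid (Fin N) →* Correspondence M)
    (A : Fin N → Matrix.SpecialLinearGroup (Fin 2) ℝ) : Prop :=
  ∃ es eu, IsHyperbolicSplitting A es eu ∧ ∃ e : M → Set P1,
    Set.BijOn e P.unstable (components (unstableCore es eu)) ∧
    Set.BijOn e P.stable (components (stableCore es eu)) ∧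
    ((∀ x y z, sbtw x y z → ∀ p ∈ e x, ∀ q ∈ e y, ∀ r ∈ e z, P1.Sbtw p q r) ∨
     (∀ x y z, sbtw x y z → ∀ p ∈ e x, ∀ q ∈ e y, ∀ r ∈ e z, P1.Sbtw r q p)) ∧
    ∀ i x y, (x, y) ∈ Φ (FreeMonoid.of i) ↔
      ((x ∈ P.unstable ∧ y ∈ P.unstable) ∨ (x ∈ P.stable ∧ y ∈ P.stable)) ∧
      (((fun p => A i • p) '' e x) ∩ e y).Nonempty

end Matrices

end MulticoneDynamics

namespace MulticoneDynamics

/-! The obstruction is a cross-ratio. For eight points `v₀, …, v₇` in cyclic order, the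
quadrilaterals `v₀v₁v₄v₅` and `v₂v₃v₆v₇` have cross-ratios `|v₀v₁||v₄v₅| / |v₁v₄||v₀v₅|` and
`|v₂v₃||v₆v₇| / |v₃v₆||v₂v₇|`, where `|uv|` is the absolute determinant; their product is less than
one (`abs_det2_mul_lt`). Suppose that a matrix `A` sends `v₅, v₀` to one component and `v₁, v₄` to
another, that `B` does the same with `v₇, v₂` and `v₃, v₆`, and that the components reached by `A`
and `B` alternate. The eight images are then in cyclic order too, but with the opposite sides of
each quadrilateral exchanged, so the same inequality bounds the inverse product by one. Since
determinants are invariant, this is absurd (`MulticonePair.not_isInducedBy`).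

It remains to find this pattern in a tight hyperbolic morphism. On `Fin 30`, two generators are
"folds", whose stable and unstable maps take two values each. These values lie where both folds are
constant, so any product of two generators is constant. Adding fifteen constant generators makes the
morphism tight. Monotonicity is checked on explicit closed paths of thirty steps. -/

/-! ### A cross-ratio inequality for eight points of the projective line -/

/-- The vectors `u`, `v`, `w` represent three distinct points of the projective line, met in this
cyclic order for the orientation given by the sign of `ε`. -/
def DetSbtw (ε : ℝ) (u v w : Fin 2 → ℝ) : Prop :=
  0 < ε * (det2 u v * det2 v w * det2 u w)

theorem det2_antisymm (u v : Fin 2 → ℝ) : det2 u v = -det2 v u := by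
  simp only [det2]; ring

theorem DetSbtw.rotate {ε : ℝ} {u v w : Fin 2 → ℝ} (h : DetSbtw ε u v w) : DetSbtw ε v w u := by
  unfold DetSbtw at *
  rw [det2_antisymm w u, det2_antisymm v u]
  linarith

theorem det2_smul_smul (a b : ℝ) (u v : Fin 2 → ℝ) : det2 (a • u) (b • v) = a * b * det2 u v := by
  simp only [det2, Pi.smul_apply, smul_eq_mul]; ring

theorem DetSbtw.of_smul {ε a b c : ℝ} {u v w : Fin 2 → ℝ}
    (h : DetSbtw ε (a • u) (b • v) (c • w)) : DetSbtw ε u v w := by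
  unfold DetSbtw at *
  simp only [det2_smul_smul] at h
  have h' : 0 < (a * b * c) ^ 2 * (ε * (det2 u v * det2 v w * det2 u w)) := by
    convert h using 1; ring
  exact pos_of_mul_pos_right h' (sq_nonneg _)

theorem detSbtw_one_of_sbtw {u v w : Fin 2 → ℝ} (hu : u ≠ 0) (hv : v ≠ 0) (hw : w ≠ 0)
    (h : P1.Sbtw (Projectivization.mk ℝ u hu) (Projectivization.mk ℝ v hv)
      (Projectivization.mk ℝ w hw)) : DetSbtw 1 u v w := by
  obtain ⟨a, ha⟩ := Projectivization.exists_smul_eq_mk_rep ℝ u hu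
  obtain ⟨b, hb⟩ := Projectivization.exists_smul_eq_mk_rep ℝ v hv
  obtain ⟨c, hc⟩ := Projectivization.exists_smul_eq_mk_rep ℝ w hw
  refine DetSbtw.of_smul (a := (a : ℝ)) (b := (b : ℝ)) (c := (c : ℝ)) ?_
  unfold DetSbtw
  unfold P1.Sbtw at h
  rw [← ha, ← hb, ← hc] at h
  simpa only [one_mul, Units.smul_def] using h

theorem detSbtw_neg_one_of_sbtw {u v w : Fin 2 → ℝ} (hu : u ≠ 0) (hv : v ≠ 0) (hw : w ≠ 0)
    (h : P1.Sbtw (Projectivization.mk ℝ w hw) (Projectivization.mk ℝ v hv)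
      (Projectivization.mk ℝ u hu)) : DetSbtw (-1) u v w := by
  have := detSbtw_one_of_sbtw hw hv hu h
  unfold DetSbtw at *
  rw [det2_antisymm u v, det2_antisymm v w, det2_antisymm u w]
  linarith

theorem det2_smul (A : Matrix.SpecialLinearGroup (Fin 2) ℝ) (u v : Fin 2 → ℝ) :
    det2 (A • u) (A • v) = det2 u v := by
  have h := A.det_coe
  rw [Matrix.det_fin_two] at h
  simp only [det2, Matrix.SpecialLinearGroup.smul_def, Matrix.smul_eq_mulVec, Matrix.mulVec,
    dotProduct, Fin.sum_univ_two]
  linear_combination (u 0 * v 1 - u 1 * v 0) * h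

theorem DetSbtw.smul {ε : ℝ} {u v w : Fin 2 → ℝ} (h : DetSbtw ε u v w)
    (A : Matrix.SpecialLinearGroup (Fin 2) ℝ) : DetSbtw ε (A • u) (A • v) (A • w) := by
  simpa only [DetSbtw, det2_smul] using h

/-- An affine coordinate on the projective line, with the point represented by `b` at infinity. -/
theorem exists_affine_coordinate {ε : ℝ} (hε : ε * ε = 1) {b : Fin 2 → ℝ} (hb : b ≠ 0) :
    ∃ x : (Fin 2 → ℝ) → ℝ, ∀ v w, det2 b v ≠ 0 → det2 b w ≠ 0 →
      det2 v w = ε * (det2 b v * det2 b w * (x w - x v)) := by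
  have hn : b 0 ^ 2 + b 1 ^ 2 ≠ 0 := by
    intro h
    apply hb
    have h0 : b 0 = 0 := by nlinarith [sq_nonneg (b 0), sq_nonneg (b 1)]
    have h1 : b 1 = 0 := by nlinarith [sq_nonneg (b 0), sq_nonneg (b 1)]
    ext i; fin_cases i <;> simp [h0, h1]
  refine ⟨fun v => -ε * (b 0 * v 0 + b 1 * v 1) / (det2 b v * (b 0 ^ 2 + b 1 ^ 2)), ?_⟩
  intro v w hv hw
  field_simp
  simp only [det2]
  linear_combination (-(v 0 * w 1 - v 1 * w 0) * (b 0 ^ 2 + b 1 ^ 2)) * hε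

/-- For eight points `v₁, …, v₈` in cyclic order, the cross-ratios of the disjoint quadrilaterals
`(v₁ v₂ v₅ v₆)` and `(v₃ v₄ v₇ v₈)`, with linked pairs of sides, have a product less than one. -/
theorem abs_det2_mul_lt {ε : ℝ} (hε : ε * ε = 1) {v₁ v₂ v₃ v₄ v₅ v₆ v₇ v₈ : Fin 2 → ℝ}
    (h125 : DetSbtw ε v₁ v₂ v₅) (h135 : DetSbtw ε v₁ v₃ v₅) (h145 : DetSbtw ε v₁ v₄ v₅)
    (h156 : DetSbtw ε v₁ v₅ v₆) (h167 : DetSbtw ε v₁ v₆ v₇) (h137 : DetSbtw ε v₁ v₃ v₇)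
    (h147 : DetSbtw ε v₁ v₄ v₇) (h138 : DetSbtw ε v₁ v₃ v₈) (h235 : DetSbtw ε v₂ v₃ v₅)
    (h347 : DetSbtw ε v₃ v₄ v₇) (h378 : DetSbtw ε v₃ v₇ v₈) :
    |det2 v₁ v₂ * det2 v₅ v₆ * det2 v₃ v₄ * det2 v₇ v₈| <
      |det2 v₂ v₅ * det2 v₁ v₆ * det2 v₄ v₇ * det2 v₃ v₈| := by
  have ne₁ : ∀ {v w}, DetSbtw ε v₁ v w → det2 v₁ v ≠ 0 := by
    rintro v w h h0
    simp [DetSbtw, h0] at h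
  have ne₂ : ∀ {v w}, DetSbtw ε v₁ v w → det2 v₁ w ≠ 0 := by
    rintro v w h h0
    simp [DetSbtw, h0] at h
  have hb : v₁ ≠ 0 := by
    rintro rfl
    exact ne₁ h125 (by simp [det2])
  obtain ⟨x, hx⟩ := exists_affine_coordinate hε hb
  have lt : ∀ {v w}, DetSbtw ε v₁ v w → x v < x w := by
    intro v w h
    have hv := ne₁ h
    have hw := ne₂ h
    unfold DetSbtw at h
    rw [hx v w hv hw] at h
    have h' : 0 < (det2 v₁ v * det2 v₁ w) ^ 2 * (x w - x v) := by
      convert h using 1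
      linear_combination (-(det2 v₁ v * det2 v₁ w) ^ 2 * (x w - x v)) * hε
    linarith [pos_of_mul_pos_right h' (sq_nonneg _)]
  have cyc : ∀ {u v w}, det2 v₁ u ≠ 0 → det2 v₁ v ≠ 0 → det2 v₁ w ≠ 0 → DetSbtw ε u v w →
      0 < (x v - x u) * (x w - x v) * (x w - x u) := by
    intro u v w hu hv hw h
    unfold DetSbtw at h
    rw [hx u v hu hv, hx v w hv hw, hx u w hu hw] at h
    have h' : 0 < (det2 v₁ u * det2 v₁ v * det2 v₁ w) ^ 2 *
        ((x v - x u) * (x w - x v) * (x w - x u)) := by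
      convert h using 1
      linear_combination (-(det2 v₁ u * det2 v₁ v * det2 v₁ w) ^ 2 *
        ((x v - x u) * (x w - x v) * (x w - x u)) * (ε * ε + 1)) * hε
    exact pos_of_mul_pos_right h' (sq_nonneg _)
  have n2 := ne₁ h125
  have n3 := ne₁ h135
  have n4 := ne₁ h145
  have n5 := ne₂ h125
  have n6 := ne₂ h156
  have n7 := ne₂ h147
  have n8 := ne₂ h138
  have l25 := lt h125
  have l35 := lt h135
  have l45 := lt h145
  have l56 := lt h156
  have l67 := lt h167
  have l37 := lt h137
  have l47 := lt h147
  have l38 := lt h138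
  have mid : ∀ {a b c : ℝ}, 0 < (b - a) * (c - b) * (c - a) → a < c → b < c → a < b := by
    intro a b c h h1 h2
    have := pos_of_mul_pos_left (pos_of_mul_pos_left h (sub_pos.2 h1).le) (sub_pos.2 h2).le
    linarith
  have l23 : x v₂ < x v₃ := mid (cyc n2 n3 n5 h235) l25 l35
  have l34 : x v₃ < x v₄ := mid (cyc n3 n4 n7 h347) l37 l47
  have l78 : x v₇ < x v₈ := by
    have := cyc n3 n7 n8 h378
    have := pos_of_mul_pos_right (pos_of_mul_pos_left this (sub_pos.2 l38).le) (sub_pos.2 l37).le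
    linarith
  rw [hx _ _ n5 n6, hx _ _ n3 n4, hx _ _ n7 n8, hx _ _ n2 n5, hx _ _ n4 n7, hx _ _ n3 n8]
  -- With `v₁` at infinity the other coordinates increase from `v₂` to `v₈`. The three intervals on
  -- the left are strictly contained in those on the right, factor by factor.
  have key : (x v₆ - x v₅) * (x v₄ - x v₃) * (x v₈ - x v₇) <
      (x v₇ - x v₄) * (x v₅ - x v₂) * (x v₈ - x v₃) := by
    have : 0 < x v₆ - x v₅ := by linarith
    have : 0 < x v₄ - x v₃ := by linarith
    have : 0 < x v₈ - x v₇ := by linarith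
    gcongr
  have hp : ∀ {a b : ℝ}, a < b → 0 < b - a := fun h => sub_pos.2 h
  -- The common factor of both sides: each of the eight vectors has the same degree on the left and
  -- on the right.
  set k := ε * ε * ε * (det2 v₁ v₂ * det2 v₁ v₃ * det2 v₁ v₄ * det2 v₁ v₅ * det2 v₁ v₆ *
    det2 v₁ v₇ * det2 v₁ v₈) with hk
  have hk0 : k ≠ 0 := by
    have : ε ≠ 0 := by rintro rfl; simp at hε
    positivity
  have e1 : det2 v₁ v₂ * (ε * (det2 v₁ v₅ * det2 v₁ v₆ * (x v₆ - x v₅))) *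
      (ε * (det2 v₁ v₃ * det2 v₁ v₄ * (x v₄ - x v₃))) *
      (ε * (det2 v₁ v₇ * det2 v₁ v₈ * (x v₈ - x v₇))) =
      k * ((x v₆ - x v₅) * (x v₄ - x v₃) * (x v₈ - x v₇)) := by rw [hk]; ring
  have e2 : ε * (det2 v₁ v₂ * det2 v₁ v₅ * (x v₅ - x v₂)) * det2 v₁ v₆ *
      (ε * (det2 v₁ v₄ * det2 v₁ v₇ * (x v₇ - x v₄))) *
      (ε * (det2 v₁ v₃ * det2 v₁ v₈ * (x v₈ - x v₃))) =
      k * ((x v₇ - x v₄) * (x v₅ - x v₂) * (x v₈ - x v₃)) := by rw [hk]; ring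
  have q1 := hp l56
  have q2 := hp l34
  have q3 := hp l78
  rw [e1, e2, abs_mul, abs_mul k]
  refine mul_lt_mul_of_pos_left ?_ (abs_pos.2 hk0)
  rw [abs_of_pos (by positivity), abs_of_pos (lt_trans (by positivity) key)]
  exact key


/-! ### The obstruction to being induced by matrices -/

/-- A morphism is not induced by matrices if, for eight elements `d₀, …, d₇` in cyclic order, a
generator maps `d₅, d₀` and `d₁, d₄` to `t₀` and `t₂`, another one maps `d₇, d₂` and `d₃, d₆` to
`t₁` and `t₃`, and `t₀, t₁, t₂, t₃` are in cyclic order: the invariance of the cross-ratios of the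
two quadrilaterals contradicts `abs_det2_mul_lt`. -/
theorem MulticonePair.not_isInducedBy {M : Type*} [Finite M] [CircularOrder M]
    {P : MulticonePair M} {N : ℕ} {Φ : FreeMonoid (Fin N) →* Correspondence M} (i j : Fin N)
    (d : Fin 8 → M) (hd : ∀ k l m, k < l → l < m → sbtw (d k) (d l) (d m))
    (t : Fin 4 → M) (ht : ∀ k l m, k < l → l < m → sbtw (t k) (t l) (t m))
    (h0 : (d 0, t 0) ∈ Φ (FreeMonoid.of i)) (h5 : (d 5, t 0) ∈ Φ (FreeMonoid.of i))
    (h1 : (d 1, t 2) ∈ Φ (FreeMonoid.of i)) (h4 : (d 4, t 2) ∈ Φ (FreeMonoid.of i))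
    (h2 : (d 2, t 1) ∈ Φ (FreeMonoid.of j)) (h7 : (d 7, t 1) ∈ Φ (FreeMonoid.of j))
    (h3 : (d 3, t 3) ∈ Φ (FreeMonoid.of j)) (h6 : (d 6, t 3) ∈ Φ (FreeMonoid.of j))
    (A : Fin N → Matrix.SpecialLinearGroup (Fin 2) ℝ) : ¬ P.IsInducedBy Φ A := by
  rintro ⟨es, eu, -, e, -, -, hord, hmem⟩
  obtain ⟨ε, hε, hS⟩ : ∃ ε : ℝ, ε * ε = 1 ∧ ∀ x y z, sbtw x y z → ∀ u v w (hu : u ≠ 0) (hv : v ≠ 0)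
      (hw : w ≠ 0), Projectivization.mk ℝ u hu ∈ e x → Projectivization.mk ℝ v hv ∈ e y →
      Projectivization.mk ℝ w hw ∈ e z → DetSbtw ε u v w := by
    rcases hord with h | h
    · exact ⟨1, by norm_num, fun x y z hs u v w hu hv hw mu mv mw =>
        detSbtw_one_of_sbtw hu hv hw (h x y z hs _ mu _ mv _ mw)⟩
    · exact ⟨-1, by norm_num, fun x y z hs u v w hu hv hw mu mv mw =>
        detSbtw_neg_one_of_sbtw hu hv hw (h x y z hs _ mu _ mv _ mw)⟩
  have pts : ∀ {i x y}, (x, y) ∈ Φ (FreeMonoid.of i) → ∃ (v : Fin 2 → ℝ) (hv : v ≠ 0)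
      (hv' : A i • v ≠ 0), Projectivization.mk ℝ v hv ∈ e x ∧
        Projectivization.mk ℝ (A i • v) hv' ∈ e y := by
    intro i x y h
    obtain ⟨_, ⟨p, hp, rfl⟩, hq⟩ := ((hmem i x y).1 h).2
    rw [← p.mk_rep] at hp hq
    exact ⟨p.rep, p.rep_nonzero, (smul_ne_zero_iff_ne _).2 p.rep_nonzero, hp, hq⟩
  obtain ⟨v0, n0, n0', m0, m0'⟩ := pts h0
  obtain ⟨v1, n1, n1', m1, m1'⟩ := pts h1
  obtain ⟨v2, n2, n2', m2, m2'⟩ := pts h2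
  obtain ⟨v3, n3, n3', m3, m3'⟩ := pts h3
  obtain ⟨v4, n4, n4', m4, m4'⟩ := pts h4
  obtain ⟨v5, n5, n5', m5, m5'⟩ := pts h5
  obtain ⟨v6, n6, n6', m6, m6'⟩ := pts h6
  obtain ⟨v7, n7, n7', m7, m7'⟩ := pts h7
  have D : ∀ k l m, k < l → l < m → ∀ u v w (hu : u ≠ 0) (hv : v ≠ 0) (hw : w ≠ 0),
      Projectivization.mk ℝ u hu ∈ e (d k) → Projectivization.mk ℝ v hv ∈ e (d l) →
      Projectivization.mk ℝ w hw ∈ e (d m) → DetSbtw ε u v w :=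
    fun k l m hkl hlm => hS _ _ _ (hd k l m hkl hlm)
  have U : ∀ k l m, k < l → l < m → ∀ u v w (hu : u ≠ 0) (hv : v ≠ 0) (hw : w ≠ 0),
      Projectivization.mk ℝ u hu ∈ e (t k) → Projectivization.mk ℝ v hv ∈ e (t l) →
      Projectivization.mk ℝ w hw ∈ e (t m) → DetSbtw ε u v w :=
    fun k l m hkl hlm => hS _ _ _ (ht k l m hkl hlm)
  have source := abs_det2_mul_lt hε
    (D 0 1 4 (by decide) (by decide) _ _ _ n0 n1 n4 m0 m1 m4)
    (D 0 2 4 (by decide) (by decide) _ _ _ n0 n2 n4 m0 m2 m4)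
    (D 0 3 4 (by decide) (by decide) _ _ _ n0 n3 n4 m0 m3 m4)
    (D 0 4 5 (by decide) (by decide) _ _ _ n0 n4 n5 m0 m4 m5)
    (D 0 5 6 (by decide) (by decide) _ _ _ n0 n5 n6 m0 m5 m6)
    (D 0 2 6 (by decide) (by decide) _ _ _ n0 n2 n6 m0 m2 m6)
    (D 0 3 6 (by decide) (by decide) _ _ _ n0 n3 n6 m0 m3 m6)
    (D 0 2 7 (by decide) (by decide) _ _ _ n0 n2 n7 m0 m2 m7)
    (D 1 2 4 (by decide) (by decide) _ _ _ n1 n2 n4 m1 m2 m4)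
    (D 2 3 6 (by decide) (by decide) _ _ _ n2 n3 n6 m2 m3 m6)
    (D 2 6 7 (by decide) (by decide) _ _ _ n2 n6 n7 m2 m6 m7)
  -- The images in the order of the components `t 0, …, t 3`, two in each. Points in different
  -- components are ordered by `ht`; two points in the same component are ordered because they come
  -- from one matrix, which preserves the orientation of the sources.
  have target := abs_det2_mul_lt hε (v₁ := A i • v5) (v₂ := A i • v0) (v₃ := A j • v7)
    (v₄ := A j • v2) (v₅ := A i • v1) (v₆ := A i • v4) (v₇ := A j • v3) (v₈ := A j • v6)
    ((D 0 1 5 (by decide) (by decide) _ _ _ n0 n1 n5 m0 m1 m5).rotate.rotate.smul (A i))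
    (U 0 1 2 (by decide) (by decide) _ _ _ n5' n7' n1' m5' m7' m1')
    (U 0 1 2 (by decide) (by decide) _ _ _ n5' n2' n1' m5' m2' m1')
    ((D 1 4 5 (by decide) (by decide) _ _ _ n1 n4 n5 m1 m4 m5).rotate.rotate.smul (A i))
    (U 0 2 3 (by decide) (by decide) _ _ _ n5' n4' n3' m5' m4' m3')
    (U 0 1 3 (by decide) (by decide) _ _ _ n5' n7' n3' m5' m7' m3')
    (U 0 1 3 (by decide) (by decide) _ _ _ n5' n2' n3' m5' m2' m3')
    (U 0 1 3 (by decide) (by decide) _ _ _ n5' n7' n6' m5' m7' m6')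
    (U 0 1 2 (by decide) (by decide) _ _ _ n0' n7' n1' m0' m7' m1')
    ((D 2 3 7 (by decide) (by decide) _ _ _ n2 n3 n7 m2 m3 m7).rotate.rotate.smul (A j))
    ((D 3 6 7 (by decide) (by decide) _ _ _ n3 n6 n7 m3 m6 m7).rotate.rotate.smul (A j))
  simp only [det2_smul] at target
  rw [abs_mul, abs_mul, abs_mul, abs_mul, abs_mul, abs_mul] at source target
  -- After these sign changes `target` is `source` with its two sides exchanged.
  rw [det2_antisymm v5 v0, det2_antisymm v7 v2, det2_antisymm v5 v4, det2_antisymm v7 v6,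
    abs_neg, abs_neg, abs_neg, abs_neg] at target
  linarith


/-! ### Correspondences on `Fin 30` -/

theorem isNext_fin_iff {x y : Fin 30} : IsNext x y ↔ y = x + 1 := by
  constructor
  · rintro ⟨hne, h⟩
    by_contra hy
    refine h (x + 1) ?_
    rw [Fin.sbtw_iff]
    simp only [Fin.lt_def, Fin.ext_iff, Fin.val_add, Fin.val_one] at *
    omega
  · rintro rfl
    refine ⟨?_, fun z hz => ?_⟩
    · simp only [ne_eq, Fin.ext_iff, Fin.val_add, Fin.val_one]
      omega
    · rw [Fin.sbtw_iff] at hz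
      simp only [Fin.lt_def, Fin.val_add, Fin.val_one] at hz
      omega

/-- The cyclically ordered set `Fin 30`, with the odd elements stable and the even ones unstable. -/
def parityPair : MulticonePair (Fin 30) where
  stable := {x | x.val % 2 = 1}
  unstable := {x | x.val % 2 = 0}
  isCompl := by
    have h : {x : Fin 30 | x.val % 2 = 0} = {x : Fin 30 | x.val % 2 = 1}ᶜ := by
      ext x
      simp
    rw [h]
    exact isCompl_compl
  ncard_eq := by
    simp only [Set.ncard_eq_toFinset_card']
    decide
  alternate x y h := by
    rw [isNext_fin_iff] at h
    subst h
    simp only [Set.mem_ofPred_eq, Fin.val_add, Fin.val_one]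
    omega

theorem mem_stable {x : Fin 30} : x ∈ parityPair.stable ↔ x.val % 2 = 1 := Iff.rfl

theorem mem_unstable {x : Fin 30} : x ∈ parityPair.unstable ↔ x.val % 2 = 0 := Iff.rfl

/-- The correspondence with stable map `cs` and unstable map `cu`. -/
def graphCorrespondence (cs cu : Fin 30 → Fin 30) : Correspondence (Fin 30) :=
  {p | (p.1 ∈ parityPair.unstable ∧ p.2 = cu p.1) ∨ (p.1 = cs p.2 ∧ p.2 ∈ parityPair.stable)}

theorem mem_graphCorrespondence {cs cu : Fin 30 → Fin 30} {p : Fin 30 × Fin 30} :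
    p ∈ graphCorrespondence cs cu ↔
      (p.1.val % 2 = 0 ∧ p.2 = cu p.1) ∨ (p.1 = cs p.2 ∧ p.2.val % 2 = 1) := Iff.rfl

theorem correspondence_ext {C C' : Correspondence (Fin 30)} (h : ∀ x y, (x, y) ∈ C ↔ (x, y) ∈ C') :
    C = C' :=
  Set.ext fun p => h p.1 p.2

theorem graphCorrespondence_congr {cs cu cs' cu' : Fin 30 → Fin 30}
    (hs : ∀ y, y.val % 2 = 1 → cs y = cs' y) (hu : ∀ x, x.val % 2 = 0 → cu x = cu' x) :
    graphCorrespondence cs cu = graphCorrespondence cs' cu' := by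
  refine correspondence_ext fun x y => ?_
  simp only [mem_graphCorrespondence]
  constructor
  · rintro (⟨h, rfl⟩ | ⟨rfl, h⟩)
    · exact Or.inl ⟨h, hu x h⟩
    · exact Or.inr ⟨hs y h, h⟩
  · rintro (⟨h, rfl⟩ | ⟨rfl, h⟩)
    · exact Or.inl ⟨h, (hu x h).symm⟩
    · exact Or.inr ⟨(hs y h).symm, h⟩

theorem graphCorrespondence_id : graphCorrespondence id id = 1 := by
  refine correspondence_ext fun x y => ?_
  simp only [mem_graphCorrespondence, Correspondence.mem_one, id]
  constructor
  · rintro (⟨-, h⟩ | ⟨h, -⟩)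
    · exact h.symm
    · exact h
  · rintro rfl
    rcases Nat.mod_two_eq_zero_or_one x.val with h | h <;> simp [h]

/-- Stable maps go from the second coordinate to the first and unstable maps the other way, hence
the opposite orders of composition. The parity hypotheses exclude a stable pair followed by an
unstable one, and conversely. -/
theorem graphCorrespondence_mul {cs cu cs' cu' : Fin 30 → Fin 30}
    (hs : ∀ y, y.val % 2 = 1 → (cs' y).val % 2 = 1)
    (hu : ∀ x, x.val % 2 = 0 → (cu x).val % 2 = 0) :
    graphCorrespondence cs cu * graphCorrespondence cs' cu' =
      graphCorrespondence (fun y => cs (cs' y)) (fun x => cu' (cu x)) := by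
  refine correspondence_ext fun x z => ?_
  simp only [mem_graphCorrespondence, Correspondence.mem_mul]
  constructor
  · rintro ⟨y, ⟨h, rfl⟩ | ⟨rfl, h⟩, ⟨h', rfl⟩ | ⟨h'', h'⟩⟩
    · exact Or.inl ⟨h, rfl⟩
    · have := hs z h'
      have := hu x h
      rw [h''] at this
      omega
    · omega
    · exact Or.inr ⟨by rw [h''], h'⟩
  · rintro (⟨h, rfl⟩ | ⟨rfl, h⟩)
    · exact ⟨cu x, Or.inl ⟨h, rfl⟩, Or.inl ⟨hu x h, rfl⟩⟩
    · exact ⟨cs' z, Or.inr ⟨rfl, hs z h⟩, Or.inr ⟨rfl, h⟩⟩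

theorem const_eq_graphCorrespondence (as au : Fin 30) :
    parityPair.const as au = graphCorrespondence (fun _ => as) (fun _ => au) := rfl

/-! ### Monotonicity through cyclic enumerations -/

/-- A step of the cyclic order of a monotonic correspondence. -/
def stepSet : Set (Fin 30 × Fin 30) := {(2, 0), (1, 1), (0, 2)}

theorem isStep_of_sub_mem {p p' : Fin 30 × Fin 30} (h : p' - p ∈ stepSet) : IsStep p p' := by
  obtain ⟨x, y⟩ := p
  obtain ⟨x', y'⟩ := p'
  have two : ∀ a b : Fin 30, a - b = 2 → a = b + 1 + 1 := by
    intro a b h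
    rw [eq_add_of_sub_eq h, add_assoc, add_comm]
    rfl
  simp only [stepSet, Set.mem_insert_iff, Set.mem_singleton_iff, Prod.mk_sub_mk, Prod.mk.injEq] at h
  simp only [IsStep, isNext_fin_iff]
  rcases h with ⟨h1, h2⟩ | ⟨h1, h2⟩ | ⟨h1, h2⟩
  · exact Or.inl ⟨⟨x + 1, rfl, two _ _ h1⟩, sub_eq_zero.1 h2⟩
  · exact Or.inr (Or.inl ⟨by rw [add_comm]; exact eq_add_of_sub_eq h1,
      by rw [add_comm]; exact eq_add_of_sub_eq h2⟩)
  · exact Or.inr (Or.inr ⟨sub_eq_zero.1 h1, y + 1, rfl, two _ _ h2⟩)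

/-- `f` is a cyclic enumeration of the correspondence with stable map `cs` and unstable map `cu`. -/
structure IsEnumeration (cs cu : Fin 30 → Fin 30) (f : Fin 30 → Fin 30 × Fin 30) : Prop where
  odd : ∀ y, y.val % 2 = 1 → (cs y).val % 2 = 1
  even : ∀ x, x.val % 2 = 0 → (cu x).val % 2 = 0
  injective : Function.Injective f
  mem : ∀ i, f i ∈ graphCorrespondence cs cu
  exists_stable : ∀ y, y.val % 2 = 1 → ∃ i, f i = (cs y, y)
  exists_unstable : ∀ x, x.val % 2 = 0 → ∃ i, f i = (x, cu x)
  step : ∀ i, f (i + 1) - f i ∈ stepSet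

theorem IsEnumeration.isMonotonic {cs cu : Fin 30 → Fin 30} {f : Fin 30 → Fin 30 × Fin 30}
    (h : IsEnumeration cs cu f) : parityPair.IsMonotonic (graphCorrespondence cs cu) where
  same_type := by
    rintro ⟨x, y⟩ (⟨hx, rfl : y = cu x⟩ | ⟨rfl : x = cs y, hy⟩)
    · exact Or.inr ⟨hx, h.even _ hx⟩
    · exact Or.inl ⟨h.odd _ hy, hy⟩
  stable_map y hy := by
    refine ⟨cs y, ⟨h.odd y hy, Or.inr ⟨rfl, hy⟩⟩, ?_⟩
    rintro x ⟨hx, ⟨hx', -⟩ | ⟨hx', -⟩⟩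
    · simp only [mem_stable, mem_unstable] at *
      omega
    · exact hx'
  unstable_map x hx := by
    refine ⟨cu x, ⟨h.even x hx, Or.inl ⟨hx, rfl⟩⟩, ?_⟩
    rintro y ⟨hy, ⟨-, hy'⟩ | ⟨-, hy'⟩⟩
    · exact hy'
    · simp only [mem_stable, mem_unstable] at *
      omega
  cyclic := by
    let F : Fin 30 → {p // p ∈ graphCorrespondence cs cu} := fun i => ⟨f i, h.mem i⟩
    have hF : Function.Bijective F := by
      refine ⟨fun i j hij => h.injective (congrArg Subtype.val hij), ?_⟩
      rintro ⟨⟨x, y⟩, ⟨hx, rfl : y = cu x⟩ | ⟨rfl : x = cs y, hy⟩⟩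
      · obtain ⟨i, hi⟩ := h.exists_unstable x hx
        exact ⟨i, Subtype.ext hi⟩
      · obtain ⟨i, hi⟩ := h.exists_stable y hy
        exact ⟨i, Subtype.ext hi⟩
    let E := Equiv.ofBijective F hF
    let _ : LinearOrder {p // p ∈ graphCorrespondence cs cu} :=
      LinearOrder.lift' E.symm E.symm.injective
    -- The cyclic order is transported from `Fin 30` along the enumeration, so "next" means index `+
    -- 1` modulo 30, including the step that closes the path.
    refine ⟨LinearOrder.toCircularOrder _, ?_⟩
    rintro p p' ⟨hne, hp⟩
    have next : IsNext (E.symm p) (E.symm p') := by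
      refine ⟨fun hq => hne (E.symm.injective hq), fun z hz => hp (E z) ?_⟩
      rw [← E.symm_apply_apply z] at hz
      exact hz
    rw [isNext_fin_iff] at next
    have h1 : p.1 = f (E.symm p) := congrArg Subtype.val (E.apply_symm_apply p).symm
    have h2 : p'.1 = f (E.symm p + 1) := by
      rw [← next]
      exact congrArg Subtype.val (E.apply_symm_apply p').symm
    rw [h1, h2]
    exact isStep_of_sub_mem (h.step _)

/-- Translating a correspondence by a pair of even elements. -/
theorem IsEnumeration.translate {cs cu : Fin 30 → Fin 30} {f : Fin 30 → Fin 30 × Fin 30}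
    (h : IsEnumeration cs cu f) {a b : Fin 30} (ha : a.val % 2 = 0) (hb : b.val % 2 = 0) :
    IsEnumeration (fun y => cs (y - b) + a) (fun x => cu (x - a) + b) (fun i => f i + (a, b)) := by
  have add : ∀ x c : Fin 30, c.val % 2 = 0 → (x + c).val % 2 = x.val % 2 := by
    intro x c hc
    rw [Fin.val_add]
    omega
  have sub : ∀ x c : Fin 30, c.val % 2 = 0 → (x - c).val % 2 = x.val % 2 := by
    intro x c hc
    rw [← add (x - c) c hc, sub_add_cancel]
  constructor
  · intro y hy
    rw [add _ _ ha]
    exact h.odd _ (by rwa [sub _ _ hb])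
  · intro x hx
    rw [add _ _ hb]
    exact h.even _ (by rwa [sub _ _ ha])
  · exact fun i j hij => h.injective (add_right_cancel hij)
  · intro i
    have := h.mem i
    rw [mem_graphCorrespondence] at this ⊢
    simp only [Prod.fst_add, Prod.snd_add, add_sub_cancel_right, add _ _ ha, add _ _ hb]
    rcases this with ⟨h1, h2⟩ | ⟨h1, h2⟩
    · exact Or.inl ⟨h1, by rw [h2]⟩
    · exact Or.inr ⟨by rw [h1], h2⟩
  · intro y hy
    obtain ⟨i, hi⟩ := h.exists_stable (y - b) (by rwa [sub _ _ hb])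
    exact ⟨i, by simp [hi]⟩
  · intro x hx
    obtain ⟨i, hi⟩ := h.exists_unstable (x - a) (by rwa [sub _ _ ha])
    exact ⟨i, by simp [hi]⟩
  · intro i
    simpa using h.step i

theorem isEnumeration_id : IsEnumeration id id (fun i => (i, i)) where
  odd _ h := h
  even _ h := h
  injective _ _ h := (Prod.ext_iff.1 h).1
  mem i := by
    rw [graphCorrespondence_id]
    rfl
  exists_stable y _ := ⟨y, rfl⟩
  exists_unstable x _ := ⟨x, rfl⟩
  step i := by simp [stepSet]

instance (p : Fin 30 × Fin 30) : Decidable (p ∈ stepSet) :=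
  inferInstanceAs (Decidable (p = _ ∨ p = _ ∨ p = _))

instance (cs cu : Fin 30 → Fin 30) (p : Fin 30 × Fin 30) :
    Decidable (p ∈ graphCorrespondence cs cu) :=
  decidable_of_iff' _ mem_graphCorrespondence

/-- A horizontal run and a vertical run, joined by diagonal steps; `i + i` is taken modulo 30. -/
theorem isEnumeration_const : IsEnumeration (fun _ => 29) (fun _ => 0)
    (fun i => if i < 15 then (i + i, 0) else (29, i + i + 1)) := by
  constructor <;> decide

/-! ### The generators: two folds and fifteen constants -/

/-- The unstable map of a correspondence of degree two. -/
def foldU (x : Fin 30) : Fin 30 := if 1 < x ∧ x < 9 then 20 else 16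

/-- The stable map of a correspondence of degree two. -/
def foldS (y : Fin 30) : Fin 30 := if 16 < y ∧ y < 20 then 1 else 9

/-- Two horizontal runs, at heights 16 and 20, alternate with two vertical runs, at abscissas 1 and
9, all joined by diagonal steps. -/
theorem isEnumeration_fold : IsEnumeration foldS foldU
    (fun i => if i < 11 then (i + i + 10, 16) else if i < 13 then (1, i + i - 5)
      else if i < 17 then (i + i - 24, 20) else (9, i + i - 13)) := by
  constructor <;> decide

/-- The stable maps of the generators: two maps of degree two, and the constant maps. -/
def generatorS (i : Fin 17) (y : Fin 30) : Fin 30 :=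
  if i = 0 then foldS y else if i = 1 then foldS (y - 2) + 4 else Fin.ofNat 30 (2 * i.val - 3)

/-- The unstable maps of the generators: two maps of degree two, and the constant maps. -/
def generatorU (i : Fin 17) (x : Fin 30) : Fin 30 :=
  if i = 0 then foldU x else if i = 1 then foldU (x - 4) + 2 else Fin.ofNat 30 (2 * i.val - 4)

theorem isMonotonic_const {as au : Fin 30} (hs : as.val % 2 = 1) (hu : au.val % 2 = 0) :
    parityPair.IsMonotonic (graphCorrespondence (fun _ => as) (fun _ => au)) := by
  -- The model constants are 29 and 0; `as - 29` is even because `as` is odd.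
  have := (isEnumeration_const.translate (a := as - 29) (b := au) ?_ hu).isMonotonic
  · simpa using this
  · rw [Fin.val_sub]
    omega

theorem generatorS_odd : ∀ i y, (generatorS i y).val % 2 = 1 := by decide +kernel

theorem generatorU_even : ∀ i x, (generatorU i x).val % 2 = 0 := by decide +kernel

/-- The folds have stable values 1, 9 and 5, 13, while they vary only around 17, 19, 21. Similarly,
their unstable values 16, 20 and 18, 22 avoid the range from 2 to 12 where the unstable maps vary.
-/
theorem generatorS_generatorS :
    ∀ i j y, y.val % 2 = 1 → generatorS i (generatorS j y) = generatorS i (generatorS j 1) := by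
  decide +kernel

theorem generatorU_generatorU :
    ∀ i j x, x.val % 2 = 0 → generatorU i (generatorU j x) = generatorU i (generatorU j 0) := by
  decide +kernel

theorem isMonotonic_generator (i : Fin 17) :
    parityPair.IsMonotonic (graphCorrespondence (generatorS i) (generatorU i)) := by
  by_cases h0 : i = 0
  · subst h0
    exact isEnumeration_fold.isMonotonic
  by_cases h1 : i = 1
  · subst h1
    exact (isEnumeration_fold.translate (a := 4) (b := 2) (by decide) (by decide)).isMonotonic
  have hs := generatorS_odd i 0
  have hu := generatorU_even i 0
  convert isMonotonic_const hs hu using 2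
  · ext y; simp [generatorS, h0, h1]
  · ext y; simp [generatorU, h0, h1]

/-! ### The morphism and its properties -/

/-- A morphism which is not induced by matrices. -/
def foldMorphism : FreeMonoid (Fin 17) →* Correspondence (Fin 30) :=
  FreeMonoid.lift fun i => graphCorrespondence (generatorS i) (generatorU i)

theorem foldMorphism_of (i : Fin 17) :
    foldMorphism (FreeMonoid.of i) = graphCorrespondence (generatorS i) (generatorU i) :=
  FreeMonoid.lift_eval_of _ _

theorem foldMorphism_eq_const (w : FreeMonoid (Fin 17)) :
    w = 1 ∨ (∃ i, w = FreeMonoid.of i) ∨ ∃ as ∈ parityPair.stable, ∃ au ∈ parityPair.unstable,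
      foldMorphism w = parityPair.const as au := by
  induction w using FreeMonoid.inductionOn' with
  | one => exact Or.inl rfl
  | of_mul i w ih =>
    rcases ih with rfl | ⟨j, rfl⟩ | ⟨as, hs, au, hu, h⟩
    · exact Or.inr (Or.inl ⟨i, mul_one _⟩)
    · refine Or.inr (Or.inr ⟨generatorS i (generatorS j 1), generatorS_odd _ _,
        generatorU j (generatorU i 0), generatorU_even _ _, ?_⟩)
      rw [map_mul, foldMorphism_of, foldMorphism_of, const_eq_graphCorrespondence,
        graphCorrespondence_mul (fun y _ => generatorS_odd j y) (fun x _ => generatorU_even i x)]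
      exact graphCorrespondence_congr (generatorS_generatorS i j) (generatorU_generatorU j i)
    -- A generator put in front moves the stable constant by its stable map; the unstable constant
    -- is applied last and stays.
    · refine Or.inr (Or.inr ⟨generatorS i as, generatorS_odd _ _, au, hu, ?_⟩)
      rw [map_mul, foldMorphism_of, h, const_eq_graphCorrespondence, const_eq_graphCorrespondence,
        graphCorrespondence_mul (fun _ _ => hs) (fun x _ => generatorU_even i x)]

theorem foldMorphism_mem_monotonic (w : FreeMonoid (Fin 17)) :
    foldMorphism w ∈ parityPair.monotonic := by
  rcases foldMorphism_eq_const w with rfl | ⟨i, rfl⟩ | ⟨as, hs, au, hu, h⟩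
  · rw [map_one, ← graphCorrespondence_id]
    exact isEnumeration_id.isMonotonic
  · rw [foldMorphism_of]
    exact isMonotonic_generator i
  · rw [h]
    exact isMonotonic_const hs hu

theorem isHyperbolic_foldMorphism : parityPair.IsHyperbolic foldMorphism := by
  refine ⟨2, by norm_num, fun w hw => ?_⟩
  rcases foldMorphism_eq_const w with rfl | ⟨i, rfl⟩ | h
  · simp at hw
  · simp at hw
  · exact h

/-- The constant generators, `2 ≤ i ≤ 16`, already take every odd value `2 * i - 3` and every even
value `2 * i - 4`. -/
theorem exists_generatorS : ∀ x : Fin 30, x.val % 2 = 1 → ∃ i, generatorS i 1 = x := by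
  decide +kernel

theorem exists_generatorU : ∀ y : Fin 30, y.val % 2 = 0 → ∃ i, generatorU i 0 = y := by
  decide +kernel

theorem isTight_foldMorphism : parityPair.IsTight foldMorphism := by
  constructor
  · refine Set.Subset.antisymm (Set.iUnion_subset fun i y hy => hy.1) fun y hy => ?_
    obtain ⟨i, hi⟩ := exists_generatorU y hy
    refine Set.mem_iUnion.2 ⟨i, hy, 0, rfl, ?_⟩
    rw [foldMorphism_of]
    exact Or.inl ⟨rfl, hi.symm⟩
  · refine Set.Subset.antisymm (Set.iUnion_subset fun i y hy => hy.1) fun x hx => ?_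
    obtain ⟨i, hi⟩ := exists_generatorS x hx
    refine Set.mem_iUnion.2 ⟨i, hx, 1, rfl, ?_⟩
    rw [foldMorphism_of]
    exact Or.inr ⟨hi.symm, rfl⟩

theorem rank_parityPair : parityPair.rank = 15 := by
  change Set.ncard {x : Fin 30 | x.val % 2 = 0} = 15
  rw [Set.ncard_eq_toFinset_card']
  decide

theorem not_isInducedBy_foldMorphism (A : Fin 17 → Matrix.SpecialLinearGroup (Fin 2) ℝ) :
    ¬ parityPair.IsInducedBy foldMorphism A := by
  -- The unstable map of generator 0 sends 0, 10 to 16 and 2, 8 to 20; that of generator 1 sends 4,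
  -- 14 to 18 and 6, 12 to 22.
  refine MulticonePair.not_isInducedBy 0 1 ![0, 2, 4, 6, 8, 10, 12, 14] ?_ ![16, 18, 20, 22] ?_
    ?_ ?_ ?_ ?_ ?_ ?_ ?_ ?_ A
  · simp only [Fin.sbtw_iff]
    decide
  · simp only [Fin.sbtw_iff]
    decide
  all_goals
    rw [foldMorphism_of]
    decide

end MulticoneDynamics

open MulticoneDynamics in
theorem proposition5p7 :
    ∃ (N : ℕ) (M : Type) (_ : Finite M) (_ : CircularOrder M) (P : MulticonePair M)
      (Φ : FreeMonoid (Fin N) →* Correspondence M),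
      2 ≤ N ∧ P.rank = 15 ∧ (∀ w, Φ w ∈ P.monotonic) ∧ P.IsTight Φ ∧ P.IsHyperbolic Φ ∧
      ∀ A : Fin N → Matrix.SpecialLinearGroup (Fin 2) ℝ,
        IsUniformlyHyperbolic A → ¬ P.IsInducedBy Φ A :=
  ⟨17, Fin 30, inferInstance, inferInstance, parityPair, foldMorphism, by norm_num,
    rank_parityPair, foldMorphism_mem_monotonic, isTight_foldMorphism, isHyperbolic_foldMorphism,
    fun A _ => not_isInducedBy_foldMorphism A⟩
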